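/- All graphs are finite, undirected and simple. For a graph $G$ let $\sigma_L(G)$ be its Laplacian spectrum, that is, the multiset of eigenvalues of the Laplacian matrix $L(G)=D(G)-A(G)$, counted with multiplicity. A graph $G$ is said to realize a multiset $S$ if $G$ is connected and $\sigma_L(G)=S$. For integers $i,n$ put $S_{i,n}=\{0,1,2,\ldots,n\}\setminus\{i\}$, and let $S_{\{i,j\}_n^m}=\{0,1,\ldots,m-1,m,m,m+1,\ldots,n\}\setminus\{i,j\}$ (the number $m$ is doubled; $i$ and $j$ are removed). Let $K_p$ and $P_p$ be the complete graph and the path on $p$ vertices, $\cup$ the disjoint union and $\vee$ the join of graphs; equality of graphs is understood up to isomorphism. **Theorem.** Let $G$ be a graph of order $n\geq 5$. (a) $G$ realizes $S_{\{1,2\}_n^n}$ if and only if $G$ is formed in one of the following two ways: (i) $G=P_3\vee(K_1\cup H)$, where $H$ is a graph on $n-4$ vertices that realizes $S_{n-5,n-4}$; (ii) $G=K_2\vee H$, where $H$ is a graph on $n-2$ vertices that realizes $S_{n-2,n-2}$. (b) If $3\leq j\leq n-2$, then $G$ realizes $S_{\{1,j\}_n^n}$ if and only if $G=K_2\vee(K_1\cup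 H)$, where $H$ is a graph on $n-3$ vertices that realizes $S_{j-2,n-3}$. (c) $G$ realizes $S_{\{1,n-1\}_n^n}$ if and only if $G$ is formed in one of the following two ways: (i) $G=K_2\vee(K_2\cup H)$, where $H$ is a graph on $n-4$ vertices that realizes $S_{2,n-4}$; (ii) $G=K_2\vee(K_1\cup H)$, where $H$ is a graph on $n-3$ vertices that realizes $S_{n-3,n-3}$. -/

import Mathlib

/-- The Laplacian spectrum of a finite simple graph: the multiset of eigenvalues (with
multiplicity) of its Laplacian matrix, that is, the roots of its characteristic polynomial. -/
noncomputable def laplacianSpectrum {V : Type*} [Fintype V] (G : SimpleGraph V) : Multiset ℝ := by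
  classical exact (G.lapMatrix ℝ).charpoly.roots

/-- The graph `G` realizes the multiset `S`: it is connected and its Laplacian spectrum is `S`. -/
def LapRealizes {V : Type*} [Fintype V] (G : SimpleGraph V) (S : Multiset ℕ) : Prop :=
  G.Connected ∧ laplacianSpectrum G = S.map (fun k : ℕ => (k : ℝ))

/-- `S_{i,n} = {0, 1, ..., n} \ {i}`. -/
def lapSetOne (i n : ℕ) : Multiset ℕ :=
  (Multiset.range (n + 1)).filter (fun k => k ≠ i)

/-- `S_{{i,j}_n^m}`: the set `{0, 1, ..., n}` with `m` doubled, from which `i` and `j` are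
removed. -/
def lapSetTwo (i j n m : ℕ) : Multiset ℕ :=
  (m ::ₘ Multiset.range (n + 1)).filter (fun k => k ≠ i ∧ k ≠ j)

/-- The join of two graphs: the complement of the disjoint union of their complements. -/
def graphJoin {V W : Type*} (G : SimpleGraph V) (H : SimpleGraph W) : SimpleGraph (V ⊕ W) :=
  (Gᶜ ⊕g Hᶜ)ᶜ

/-- The disjoint union of two graphs. -/
def graphUnion {V W : Type*} (G : SimpleGraph V) (H : SimpleGraph W) : SimpleGraph (V ⊕ W) :=
  G ⊕g H

/-- The complete graph on `n` vertices. -/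
def graphK (n : ℕ) : SimpleGraph (Fin n) := SimpleGraph.completeGraph (Fin n)

/-- `G` and `H` are the same graph up to the names of the vertices. -/
def GraphIsomorphic {V W : Type*} (G : SimpleGraph V) (H : SimpleGraph W) : Prop :=
  Nonempty (G ≃g H)

/-! ### Spectra under disjoint union and complement; zeros count components. -/

section LaplacianSpectrum

open Polynomial SimpleGraph

variable {V W : Type*} [Fintype V] [Fintype W]

/-! Pass to the complement. On `n` vertices, complementation keeps one zero and sends every other
eigenvalue `x` to `n - x` (`laplacianSpectrum_compl`). The doubled `n` therefore gives the
complement of `G` exactly three zeros, that is, three components. The missing `1` and `j` make its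
largest eigenvalue `n - 2`, or `n - 3` when `j = 2`.

An eigenvalue belongs to some component and is at most the order of that component
(`exists_connected_iso_sum_of_mem`). So one component has all but two or three vertices, and the
other two components form `2K_1` or `K_1 ∪ K_2`, the complements of `K_2` and `P_3`. Hence `G` is a
join with `K_2` or `P_3`, and the spectrum of the other factor follows by cancelling multisets.

Except in the `K_2` case of `j = 2`, the other factor has exactly two zeros, and the same size
argument splits off a `K_1`, or possibly a `K_2` when `j = n - 1`. Conversely, connectedness can be
read from the spectrum, so it is enough to compute the spectrum of each join. -/

theorem laplacianSpectrum_eq [DecidableEq V] (G : SimpleGraph V) [DecidableRel G.Adj] :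
    laplacianSpectrum G = (G.lapMatrix ℝ).charpoly.roots := by
  unfold laplacianSpectrum
  convert rfl

theorem lapMatrix_apply' [DecidableEq V] (G : SimpleGraph V) [DecidableRel G.Adj] (i j : V) :
    G.lapMatrix ℝ i j = (if i = j then (G.degree i : ℝ) else 0) - if G.Adj i j then 1 else 0 := by
  simp [SimpleGraph.lapMatrix, SimpleGraph.degMatrix, Matrix.diagonal_apply]

theorem laplacianSpectrum_iso {G : SimpleGraph V} {H : SimpleGraph W} (e : G ≃g H) :
    laplacianSpectrum G = laplacianSpectrum H := by
  classical
  rw [laplacianSpectrum_eq, laplacianSpectrum_eq, ← Matrix.charpoly_reindex e.toEquiv]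
  congr 2
  ext i j
  obtain ⟨i, rfl⟩ := e.surjective i
  obtain ⟨j, rfl⟩ := e.surjective j
  have h1 : ∀ x, e.toEquiv.symm (e x) = x := e.toEquiv.symm_apply_apply
  simp only [Matrix.reindex_apply, Matrix.submatrix_apply, lapMatrix_apply', h1]
  simp [SimpleGraph.Iso.map_adj_iff]

theorem card_laplacianSpectrum (G : SimpleGraph V) :
    (laplacianSpectrum G).card = Fintype.card V := by
  classical
  rw [laplacianSpectrum_eq, (G.isHermitian_lapMatrix ℝ).roots_charpoly_eq_eigenvalues]
  simp

theorem prod_laplacianSpectrum [DecidableEq V] (G : SimpleGraph V) [DecidableRel G.Adj] :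
    ((laplacianSpectrum G).map (fun a => X - C a)).prod = (G.lapMatrix ℝ).charpoly := by
  rw [laplacianSpectrum_eq]
  exact ((G.isHermitian_lapMatrix ℝ).splits_charpoly.eq_prod_roots_of_monic
    (Matrix.charpoly_monic _)).symm

theorem laplacianSpectrum_nonneg (G : SimpleGraph V) {x : ℝ} (hx : x ∈ laplacianSpectrum G) :
    0 ≤ x := by
  classical
  have h : (G.lapMatrix ℝ).PosSemidef := G.posSemidef_lapMatrix ℝ
  rw [laplacianSpectrum_eq, h.1.roots_charpoly_eq_eigenvalues] at hx
  simp only [Multiset.mem_map] at hx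
  obtain ⟨i, -, rfl⟩ := hx
  exact h.eigenvalues_nonneg i

/-- The Laplacian is symmetric, so the multiplicity of `0` is the nullity, and the kernel has
dimension the number of components. -/
theorem count_zero_laplacianSpectrum (G : SimpleGraph V) :
    (laplacianSpectrum G).count 0 = Nat.card G.ConnectedComponent := by
  classical
  have hA := G.isHermitian_lapMatrix ℝ
  have hr := hA.rank_eq_card_non_zero_eigs
  have hk := G.card_connectedComponent_eq_finrank_ker_toLin'_lapMatrix
  have hs := LinearMap.finrank_range_add_finrank_ker (G.lapMatrix ℝ).toLin'
  have hc : Fintype.card {i // hA.eigenvalues i ≠ 0} =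
      Fintype.card V - Fintype.card {i // hA.eigenvalues i = 0} := by
    rw [← Fintype.card_subtype_compl]
  have hle := Fintype.card_subtype_le (fun i => hA.eigenvalues i = 0)
  change (G.lapMatrix ℝ).rank + _ = _ at hs
  rw [laplacianSpectrum_eq, hA.roots_charpoly_eq_eigenvalues, Multiset.count_map,
    Nat.card_eq_fintype_card, hk]
  have : Fintype.card {i // hA.eigenvalues i = 0} =
      (Multiset.filter (fun i => 0 = ((hA.eigenvalues i : ℝ) : ℝ)) Finset.univ.val).card := by
    rw [Fintype.card_subtype]
    simp only [Finset.card_def, Finset.filter_val]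
    congr 1
    ext; simp [eq_comm]
  simp only [Module.finrank_fintype_fun_eq_card] at hs
  simp only [RCLike.ofReal_real_eq_id, Function.comp_def, id] at *
  omega

theorem connected_iff_count_zero (G : SimpleGraph V) :
    G.Connected ↔ (laplacianSpectrum G).count 0 = 1 := by
  rw [count_zero_laplacianSpectrum, Nat.card_eq_one_iff_unique]
  constructor
  · intro h
    exact ⟨h.preconnected.subsingleton_connectedComponent,
      h.nonempty.map G.connectedComponentMk⟩
  · rintro ⟨h1, ⟨c⟩⟩
    have : Nonempty V := ⟨c.nonempty_supp.some⟩
    exact ⟨fun u v => ConnectedComponent.exact (Subsingleton.elim _ _)⟩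

theorem laplacianSpectrum_sum (G : SimpleGraph V) (H : SimpleGraph W) :
    laplacianSpectrum (G ⊕g H) = laplacianSpectrum G + laplacianSpectrum H := by
  classical
  have hd1 (v : V) [Fintype ((G ⊕g H).neighborSet (Sum.inl v))] : (G ⊕g H).degree (Sum.inl v) = G.degree v := by
    have : (G ⊕g H).neighborFinset (Sum.inl v) =
        (G.neighborFinset v).map Function.Embedding.inl := by
      ext (x | x) <;> simp
    rw [SimpleGraph.degree, this, Finset.card_map, SimpleGraph.degree]
  have hd2 (v : W) [Fintype ((G ⊕g H).neighborSet (Sum.inr v))] : (G ⊕g H).degree (Sum.inr v) = H.degree v := by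
    have : (G ⊕g H).neighborFinset (Sum.inr v) =
        (H.neighborFinset v).map Function.Embedding.inr := by
      ext (x | x) <;> simp
    rw [SimpleGraph.degree, this, Finset.card_map, SimpleGraph.degree]
  have h : (G ⊕g H).lapMatrix ℝ = Matrix.fromBlocks (G.lapMatrix ℝ) 0 0 (H.lapMatrix ℝ) := by
    ext (i | i) (j | j) <;> simp [lapMatrix_apply', hd1, hd2]
  rw [laplacianSpectrum_eq, h, Matrix.charpoly_fromBlocks_zero₁₂,
    roots_mul (mul_ne_zero (Matrix.charpoly_monic _).ne_zero (Matrix.charpoly_monic _).ne_zero),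
    ← laplacianSpectrum_eq, ← laplacianSpectrum_eq]

theorem lapMatrix_compl [DecidableEq V] (G : SimpleGraph V) [DecidableRel G.Adj] :
    Gᶜ.lapMatrix ℝ = Matrix.scalar V (Fintype.card V : ℝ) - Matrix.of (fun _ _ => 1)
      - G.lapMatrix ℝ := by
  ext i j
  have hd : (Gᶜ.degree i : ℝ) = Fintype.card V - 1 - G.degree i := by
    have h1 := G.degree_compl i
    have h2 := G.degree_lt_card_verts i
    rw [h1, Nat.sub_sub, Nat.cast_sub (by omega)]
    push_cast; ring
  simp only [Matrix.sub_apply, lapMatrix_apply', hd, Matrix.scalar_apply, Matrix.diagonal_apply,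
    Matrix.of_apply, compl_adj]
  by_cases hij : i = j
  · subst hij; simp
  · by_cases ha : G.Adj i j <;> simp [hij, ha]

/-- Constant row sums mean `M` sends the all-ones vector to `c` times itself, so adding the all-ones
matrix `J` is right multiplication by `1 + c⁻¹ J`, whose determinant is that of a rank-one update.
-/
theorem det_add_of_one [DecidableEq V] (M : Matrix V V ℝ) {c : ℝ} (hc : c ≠ 0)
    (hM : ∀ i, ∑ j, M i j = c) :
    c * (M + Matrix.of (fun _ _ => 1)).det = (c + Fintype.card V) * M.det := by
  have h : M + Matrix.of (fun _ _ => 1) =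
      M * (1 + Matrix.replicateCol Unit (fun _ : V => c⁻¹) *
        Matrix.replicateRow Unit (fun _ : V => (1 : ℝ))) := by
    rw [mul_add, mul_one]
    congr 1
    ext i j
    simp [Matrix.mul_apply, ← Finset.sum_mul, hM, hc]
  rw [h, Matrix.det_mul, Matrix.det_one_add_mul_comm]
  simp [Matrix.det_unique, Matrix.mul_apply]
  field_simp

/-- The Laplacian of `Gᶜ` is `nI - J - L`, so its characteristic matrix is `(x - n)I + L` plus `J`,
and the rank-one formula applies. The extra `n` and `0` on the two sides avoid erasing the trivial
eigenvalue. -/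
theorem laplacianSpectrum_compl (G : SimpleGraph V) :
    (Fintype.card V : ℝ) ::ₘ laplacianSpectrum Gᶜ =
      0 ::ₘ (laplacianSpectrum G).map (fun x => (Fintype.card V : ℝ) - x) := by
  classical
  set n : ℝ := (Fintype.card V : ℝ) with hn
  suffices key : (X - C n) * (Gᶜ.lapMatrix ℝ).charpoly =
      ((0 ::ₘ (laplacianSpectrum G).map (fun x => n - x)).map (fun a => X - C a)).prod by
    rw [← prod_laplacianSpectrum Gᶜ, ← Multiset.prod_cons,
      ← Multiset.map_cons (fun a => X - C a)] at key
    rw [← roots_multiset_prod_X_sub_C (n ::ₘ _), key, roots_multiset_prod_X_sub_C]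
  -- The rank-one formula needs `x ≠ n`; agreement at all other points suffices for polynomials.
  refine eq_of_infinite_eval_eq _ _
    ((Set.finite_singleton n).infinite_compl.mono fun x (hx : x ≠ n) => ?_)
  have hsum (i : V) : ∑ j, (Matrix.scalar V (x - n) + G.lapMatrix ℝ) i j = x - n := by
    have h := congrFun (G.lapMatrix_mulVec_const_eq_zero (R := ℝ)) i
    simp only [Matrix.mulVec, dotProduct, mul_one, Pi.zero_apply] at h
    simp [Finset.sum_add_distrib, h, Matrix.diagonal_apply]
  have h1 := det_add_of_one _ (sub_ne_zero.2 hx) hsum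
  have h2 : (Gᶜ.lapMatrix ℝ).charpoly.eval x =
      (Matrix.scalar V (x - n) + G.lapMatrix ℝ + Matrix.of (fun _ _ => 1)).det := by
    rw [Matrix.eval_charpoly, lapMatrix_compl, map_sub]
    congr 1
    abel
  have h3 : (((laplacianSpectrum G).map (fun x => n - x)).map (fun a => X - C a)).prod.eval x =
      (Matrix.scalar V (x - n) + G.lapMatrix ℝ).det := by
    have h4 := congrArg (eval (n - x)) (prod_laplacianSpectrum G)
    rw [Matrix.eval_charpoly, eval_multiset_prod, Multiset.map_map] at h4
    have h5 : Matrix.scalar V (n - x) - G.lapMatrix ℝ =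
        -(Matrix.scalar V (x - n) + G.lapMatrix ℝ) := by
      rw [neg_add, ← map_neg, neg_sub, sub_eq_add_neg]
    rw [h5, Matrix.det_neg] at h4
    have h6 : (-1 : ℝ) ^ Fintype.card V * (-1) ^ Fintype.card V = 1 := by
      rw [← mul_pow]; simp
    have h7 := congrArg ((-1 : ℝ) ^ Fintype.card V * ·) h4
    simp only [← mul_assoc, h6, one_mul] at h7
    rw [← h7, eval_multiset_prod, Multiset.map_map, Multiset.map_map, ← card_laplacianSpectrum G,
      ← Multiset.prod_replicate, ← Multiset.map_const', ← Multiset.prod_map_mul]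
    congr 1
    refine Multiset.map_congr rfl fun a _ => ?_
    simp
    ring
  rw [Set.mem_ofPred_eq, Multiset.map_cons, Multiset.prod_cons, eval_mul, eval_mul, h2, h3]
  simp only [eval_sub, eval_X, eval_C, sub_zero]
  rw [h1, ← hn, sub_add_cancel]

end LaplacianSpectrum

/-! ### Splitting off a component that carries a given eigenvalue. -/

section Decomposition

open SimpleGraph

variable {V W V' W' : Type*}

theorem nonempty_compl_iso {G : SimpleGraph V} {H : SimpleGraph W} (h : Nonempty (G ≃g H)) :
    Nonempty (Gᶜ ≃g Hᶜ) := by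
  obtain ⟨e⟩ := h
  exact ⟨⟨e.toEquiv, fun {a b} => by simp [SimpleGraph.compl_adj, e.map_adj_iff]⟩⟩

theorem graphJoin_congr {G : SimpleGraph V} {H : SimpleGraph W} {G' : SimpleGraph V'}
    {H' : SimpleGraph W'} (h₁ : Nonempty (G ≃g G')) (h₂ : Nonempty (H ≃g H')) :
    Nonempty (graphJoin G H ≃g graphJoin G' H') := by
  obtain ⟨e₁⟩ := nonempty_compl_iso h₁
  obtain ⟨e₂⟩ := nonempty_compl_iso h₂
  exact nonempty_compl_iso ⟨Iso.sumCongr e₁ e₂⟩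

theorem graphIsomorphic_graphJoin_of_compl {G : SimpleGraph V} {A : SimpleGraph V'}
    {B : SimpleGraph W'} {K : SimpleGraph W} (h : Nonempty (Gᶜ ≃g A ⊕g B))
    (hB : Nonempty (B ≃g Kᶜ)) : GraphIsomorphic G (graphJoin K Aᶜ) := by
  obtain ⟨e⟩ := h
  obtain ⟨f⟩ := hB
  have h := nonempty_compl_iso ⟨(e.trans Iso.sumComm).trans (Iso.sumCongr f (Iso.refl (G := A)))⟩
  unfold GraphIsomorphic graphJoin
  rwa [compl_compl] at h ⊢

theorem SimpleGraph.ConnectedComponent.nonempty_iso_sum {G : SimpleGraph V}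
    (c : G.ConnectedComponent) :
    Nonempty (G ≃g c.toSimpleGraph ⊕g G.induce (c.supp)ᶜ) := by
  classical
  refine ⟨Iso.symm ⟨Equiv.Set.sumCompl c.supp, ?_⟩⟩
  have hc {x y : V} (hx : x ∈ c.supp) (hy : y ∉ c.supp) : ¬ G.Adj x y := fun h =>
    hy ((c.mem_supp_congr_adj h).1 hx)
  rintro (⟨x, hx⟩ | ⟨x, hx⟩) (⟨y, hy⟩ | ⟨y, hy⟩) <;>
    change G.Adj x y ↔ _
  · simp [ConnectedComponent.toSimpleGraph]
  · simpa using hc hx hy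
  · simpa using fun h => hc hy hx (G.adj_symm h)
  · simp

theorem exists_connected_iso_sum [Fintype V] [Nonempty V] (G : SimpleGraph V) :
    ∃ (a b : ℕ) (A : SimpleGraph (Fin a)) (B : SimpleGraph (Fin b)),
      Nonempty (G ≃g A ⊕g B) ∧ A.Connected := by
  classical
  let c := G.connectedComponentMk (Classical.arbitrary V)
  obtain ⟨e⟩ := c.nonempty_iso_sum
  let f := overFinIso c.toSimpleGraph rfl
  exact ⟨_, _, _, _, ⟨e.trans (Iso.sumCongr f (overFinIso (G.induce (c.supp)ᶜ) rfl))⟩,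
    (f.connected_iff).1 c.connected_toSimpleGraph⟩

/-- Split off any component; if `x` lies in the spectrum of the rest, recurse there and move the
component found to the front. Working on `Fin` keeps the vertex type fixed up to its size during the
induction. -/
theorem exists_connected_iso_sum_of_mem_fin (n : ℕ) (G : SimpleGraph (Fin n)) {x : ℝ}
    (hx : x ∈ laplacianSpectrum G) :
    ∃ (a b : ℕ) (A : SimpleGraph (Fin a)) (B : SimpleGraph (Fin b)),
      Nonempty (G ≃g A ⊕g B) ∧ A.Connected ∧ x ∈ laplacianSpectrum A := by
  induction n using Nat.strong_induction_on with
  | _ n ih =>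
    have hn : 0 < n := by
      have := Multiset.card_pos_iff_exists_mem.2 ⟨x, hx⟩
      rwa [card_laplacianSpectrum, Fintype.card_fin] at this
    have : Nonempty (Fin n) := ⟨⟨0, hn⟩⟩
    obtain ⟨a, b, A, B, ⟨e⟩, hA⟩ := exists_connected_iso_sum G
    have hx' := hx
    rw [laplacianSpectrum_iso e, laplacianSpectrum_sum, Multiset.mem_add] at hx'
    rcases hx' with h | h
    · exact ⟨a, b, A, B, ⟨e⟩, hA, h⟩
    · have hab : n = a + b := by simpa using Fintype.card_congr e.toEquiv
      have ha : 0 < a := Fin.pos_iff_nonempty.2 hA.nonempty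
      obtain ⟨a', b', A', B', ⟨e'⟩, hA', hx'⟩ := ih b (by omega) B h
      let f := overFinIso (A ⊕g B') rfl
      refine ⟨a', _, A', (A ⊕g B').overFin rfl, ⟨?_⟩, hA', hx'⟩
      exact (e.trans (Iso.sumCongr (Iso.refl (G := A)) e')).trans
        ((Iso.sumAssoc.symm.trans (Iso.sumCongr Iso.sumComm Iso.refl)).trans
          (Iso.sumAssoc.trans (Iso.sumCongr Iso.refl f)))

/-- The number `n - x` is `n` or an eigenvalue of the complement, hence nonnegative. -/
theorem le_card_of_mem_laplacianSpectrum [Fintype V] {G : SimpleGraph V} {x : ℝ}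
    (hx : x ∈ laplacianSpectrum G) : x ≤ Fintype.card V := by
  have h : (Fintype.card V : ℝ) - x ∈ (Fintype.card V : ℝ) ::ₘ laplacianSpectrum Gᶜ := by
    rw [laplacianSpectrum_compl]
    exact Multiset.mem_cons_of_mem (Multiset.mem_map_of_mem _ hx)
  rcases Multiset.mem_cons.1 h with h | h
  · have : (0 : ℝ) ≤ Fintype.card V := by positivity
    linarith
  · linarith [laplacianSpectrum_nonneg _ h]

theorem exists_connected_iso_sum_of_mem [Fintype V] {n k : ℕ} (hV : Fintype.card V = n)
    (G : SimpleGraph V) (hk : (k : ℝ) ∈ laplacianSpectrum G) :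
    ∃ (a b : ℕ) (A : SimpleGraph (Fin a)) (B : SimpleGraph (Fin b)),
      Nonempty (G ≃g A ⊕g B) ∧ A.Connected ∧ a + b = n ∧ k ≤ a ∧
      laplacianSpectrum A + laplacianSpectrum B = laplacianSpectrum G ∧
      (laplacianSpectrum B).count 0 + 1 = (laplacianSpectrum G).count 0 := by
  let f := overFinIso G hV
  rw [laplacianSpectrum_iso f] at hk
  obtain ⟨a, b, A, B, ⟨e⟩, hA, hx⟩ := exists_connected_iso_sum_of_mem_fin n _ hk
  have hs : laplacianSpectrum A + laplacianSpectrum B = laplacianSpectrum G := by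
    rw [laplacianSpectrum_iso f, laplacianSpectrum_iso e, laplacianSpectrum_sum]
  refine ⟨a, b, A, B, ⟨f.trans e⟩, hA, ?_, ?_, hs, ?_⟩
  · simpa using (Fintype.card_congr e.toEquiv).symm
  · simpa using le_card_of_mem_laplacianSpectrum hx
  · rw [← hs, Multiset.count_add, (connected_iff_count_zero A).1 hA, add_comm]

end Decomposition

/-! ### Integral spectra, and the graphs on at most three vertices. -/

section NatSpectrum

open SimpleGraph

variable {V W : Type*} [Fintype V] [Fintype W]

/-- The Laplacian spectrum of `G` is the multiset `S` of natural numbers. -/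
def HasNatSpectrum (G : SimpleGraph V) (S : Multiset ℕ) : Prop :=
  laplacianSpectrum G = S.map (fun k : ℕ => (k : ℝ))

theorem map_natCast_injective : Function.Injective (Multiset.map (fun k : ℕ => (k : ℝ))) :=
  Multiset.map_injective Nat.cast_injective

theorem count_zero_map_natCast (S : Multiset ℕ) :
    (S.map (fun k : ℕ => (k : ℝ))).count 0 = S.count 0 := by
  simpa using Multiset.count_map_eq_count' (fun k : ℕ => (k : ℝ)) S Nat.cast_injective 0

namespace HasNatSpectrum

variable {G : SimpleGraph V} {H : SimpleGraph W} {S T : Multiset ℕ}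

theorem card_eq (h : HasNatSpectrum G S) : S.card = Fintype.card V := by
  rw [← card_laplacianSpectrum G, h, Multiset.card_map]

theorem count_zero (h : HasNatSpectrum G S) : (laplacianSpectrum G).count 0 = S.count 0 := by
  rw [h, count_zero_map_natCast]

theorem unique (h : HasNatSpectrum G S) (h' : HasNatSpectrum G T) : S = T :=
  map_natCast_injective (h.symm.trans h')

theorem lapRealizes_iff : LapRealizes G S ↔ S.count 0 = 1 ∧ HasNatSpectrum G S := by
  unfold LapRealizes
  refine and_congr_left fun h => ?_
  rw [connected_iff_count_zero, count_zero h]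

theorem iso (h : HasNatSpectrum G S) (e : Nonempty (H ≃g G)) : HasNatSpectrum H S := by
  obtain ⟨e⟩ := e
  exact (laplacianSpectrum_iso e).trans h

theorem sum (hG : HasNatSpectrum G S) (hH : HasNatSpectrum H T) :
    HasNatSpectrum (G ⊕g H) (S + T) := by
  unfold HasNatSpectrum
  rw [laplacianSpectrum_sum, hG, hH, Multiset.map_add]

/-- The split-off `0` is the trivial eigenvalue, which stays `0`. Truncated subtraction is harmless
because eigenvalues are at most `n`. -/
theorem compl {n : ℕ} (hV : Fintype.card V = n) (h : HasNatSpectrum G (0 ::ₘ T)) :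
    HasNatSpectrum Gᶜ (0 ::ₘ T.map (fun k => n - k)) := by
  subst hV
  have hc := laplacianSpectrum_compl G
  have hT : ∀ k ∈ T, k ≤ Fintype.card V := fun k hk => by
    have : (k : ℝ) ∈ laplacianSpectrum G := by
      rw [h]; exact Multiset.mem_map_of_mem _ (Multiset.mem_cons_of_mem hk)
    exact_mod_cast le_card_of_mem_laplacianSpectrum this
  rw [h, Multiset.map_cons, Multiset.map_cons, Nat.cast_zero, sub_zero, Multiset.cons_swap,
    Multiset.cons_inj_right] at hc
  unfold HasNatSpectrum
  rw [hc, Multiset.map_cons, Nat.cast_zero, Multiset.map_map, Multiset.map_map]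
  congr 1
  refine Multiset.map_congr rfl fun k hk => ?_
  simp [Nat.cast_sub (hT k hk)]

theorem le_card (h : HasNatSpectrum G S) {k : ℕ} (hk : k ∈ S) : k ≤ Fintype.card V := by
  have : (k : ℝ) ∈ laplacianSpectrum G := by
    rw [h]; exact Multiset.mem_map_of_mem _ hk
  exact_mod_cast le_card_of_mem_laplacianSpectrum this

theorem join {p q : ℕ} (hV : Fintype.card V = p) (hW : Fintype.card W = q)
    (hG : HasNatSpectrum G (0 ::ₘ S)) (hH : HasNatSpectrum H (0 ::ₘ T)) :
    HasNatSpectrum (graphJoin G H)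
      (0 ::ₘ (p + q) ::ₘ (S.map (fun k => k + q) + T.map (fun k => k + p))) := by
  have h := (hG.compl hV).sum (hH.compl hW)
  rw [Multiset.cons_add] at h
  have h' := h.compl (n := p + q) (by simp [hV, hW])
  unfold graphJoin
  convert h' using 2
  rw [Multiset.add_cons, Multiset.map_cons, Multiset.map_add, Multiset.map_map, Multiset.map_map,
    Nat.sub_zero]
  congr 2
  · refine Multiset.map_congr rfl fun k hk => ?_
    have := hG.le_card (Multiset.mem_cons_of_mem hk)
    simp only [Function.comp_apply]
    omega
  · refine Multiset.map_congr rfl fun k hk => ?_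
    have := hH.le_card (Multiset.mem_cons_of_mem hk)
    simp only [Function.comp_apply]
    omega

/-- If `k` is an eigenvalue of `G`, then a connected component with at least `k` vertices can be
split off. -/
theorem exists_iso_sum {n k : ℕ} (hV : Fintype.card V = n) (h : HasNatSpectrum G S) (hk : k ∈ S) :
    ∃ (a b : ℕ) (A : SimpleGraph (Fin a)) (B : SimpleGraph (Fin b)),
      Nonempty (G ≃g A ⊕g B) ∧ A.Connected ∧ a + b = n ∧ k ≤ a ∧
      laplacianSpectrum A + laplacianSpectrum B = S.map (fun k : ℕ => (k : ℝ)) ∧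
      (laplacianSpectrum B).count 0 + 1 = S.count 0 := by
  have := exists_connected_iso_sum_of_mem hV G (k := k)
    (by rw [h]; exact Multiset.mem_map_of_mem _ hk)
  rwa [h.count_zero, h] at this

theorem of_add {A : SimpleGraph W} (hB : HasNatSpectrum G T)
    (h : laplacianSpectrum A + laplacianSpectrum G = (S + T).map (fun k : ℕ => (k : ℝ))) :
    HasNatSpectrum A S := by
  rwa [hB, Multiset.map_add, add_left_inj] at h

end HasNatSpectrum

theorem simpleGraph_fin_one_eq (G H : SimpleGraph (Fin 1)) : G = H := by
  ext i j
  simp [Subsingleton.elim i j]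

theorem simpleGraph_fin_two_eq (G : SimpleGraph (Fin 2)) : G = ⊥ ∨ G = ⊤ := by
  by_cases h : G.Adj 0 1
  · right
    ext i j
    fin_cases i <;> fin_cases j <;> simp [h, h.symm]
  · left
    have h' : ¬ G.Adj 1 0 := fun h1 => h h1.symm
    ext i j
    fin_cases i <;> fin_cases j <;> simp [h, h']

theorem hasNatSpectrum_bot : HasNatSpectrum (⊥ : SimpleGraph V)
    (Multiset.replicate (Fintype.card V) 0) := by
  classical
  have : (⊥ : SimpleGraph V).lapMatrix ℝ = 0 := by
    ext i j
    simp [lapMatrix_apply']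
  unfold HasNatSpectrum
  rw [laplacianSpectrum_eq, this]
  simp [Multiset.nsmul_singleton]

theorem hasNatSpectrum_bot_two : HasNatSpectrum (⊥ : SimpleGraph (Fin 2)) {0, 0} :=
  hasNatSpectrum_bot

theorem hasNatSpectrum_graphK_one : HasNatSpectrum (graphK 1) {0} := by
  rw [simpleGraph_fin_one_eq (graphK 1) ⊥]
  exact hasNatSpectrum_bot

theorem hasNatSpectrum_graphK_two : HasNatSpectrum (graphK 2) {0, 2} := by
  have h := hasNatSpectrum_bot_two.compl (n := 2) (T := {0}) (by simp)
  rw [compl_bot] at h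
  exact h

theorem nonempty_iso_compl_pathGraph_three :
    Nonempty (graphK 1 ⊕g graphK 2 ≃g (SimpleGraph.pathGraph 3)ᶜ) := by
  refine ⟨⟨⟨fun x => x.elim (fun _ => 1) (fun i => if i = 0 then 0 else 2),
    fun i => if i = 1 then .inl 0 else if i = 0 then .inr 0 else .inr 1, ?_, ?_⟩, ?_⟩⟩
  · rintro (i | i) <;> fin_cases i <;> simp
  · intro i; fin_cases i <;> simp
  · rintro (i | i) (j | j) <;> fin_cases i <;> fin_cases j <;>
      simp [graphK, SimpleGraph.pathGraph_adj]

theorem hasNatSpectrum_pathGraph_three : HasNatSpectrum (SimpleGraph.pathGraph 3) {0, 1, 3} := by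
  have h := (hasNatSpectrum_graphK_one.sum hasNatSpectrum_graphK_two).compl (n := 3)
    (T := {0, 2}) (by simp)
  have e := nonempty_compl_iso nonempty_iso_compl_pathGraph_three
  rw [compl_compl] at e
  obtain ⟨e⟩ := e
  have hm : ({0, 1, 3} : Multiset ℕ) = 0 ::ₘ Multiset.map (fun k => 3 - k) {0, 2} := by decide
  rw [hm]
  exact h.iso ⟨e.symm⟩

end NatSpectrum

/-! ### Multiset identities reduced to multiplicities and linear arithmetic. -/

section RangeMultisets

theorem count_filter_range (p : ℕ → Prop) [DecidablePred p] (k m : ℕ) :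
    ((Multiset.range k).filter p).count m = if m < k ∧ p m then 1 else 0 := by
  rw [Multiset.count_eq_of_nodup ((Multiset.nodup_range k).filter p)]
  simp [Multiset.mem_filter]

theorem map_add_filter_range (p : ℕ → Prop) [DecidablePred p] (k c : ℕ) :
    ((Multiset.range k).filter p).map (fun m => m + c) =
      (Multiset.range (k + c)).filter (fun m => c ≤ m ∧ p (m - c)) := by
  refine (Multiset.Nodup.ext (((Multiset.nodup_range k).filter p).map (add_left_injective c))
    ((Multiset.nodup_range _).filter _)).2 fun m => ?_
  simp only [Multiset.mem_map, Multiset.mem_filter, Multiset.mem_range]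
  constructor
  · rintro ⟨a, ⟨ha, hp⟩, rfl⟩
    simpa using ⟨ha, hp⟩
  · rintro ⟨h1, h2, h3⟩
    exact ⟨m - c, ⟨by omega, h3⟩, by omega⟩

theorem map_sub_filter_range (p : ℕ → Prop) [DecidablePred p] (n : ℕ) :
    ((Multiset.range (n + 1)).filter p).map (fun m => n - m) =
      (Multiset.range (n + 1)).filter (fun m => p (n - m)) := by
  refine (Multiset.Nodup.ext (((Multiset.nodup_range _).filter p).map_on ?_)
    ((Multiset.nodup_range _).filter _)).2 fun m => ?_
  · intro a ha b hb h
    simp only [Multiset.mem_filter, Multiset.mem_range] at ha hb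
    omega
  simp only [Multiset.mem_map, Multiset.mem_filter, Multiset.mem_range]
  constructor
  · rintro ⟨a, ⟨ha, hp⟩, rfl⟩
    exact ⟨by omega, by rwa [Nat.sub_sub_self (by omega)]⟩
  · rintro ⟨h1, h2⟩
    exact ⟨n - m, ⟨by omega, h2⟩, by omega⟩

theorem count_lapSetOne (i n m : ℕ) :
    (lapSetOne i n).count m = if m < n + 1 ∧ m ≠ i then 1 else 0 :=
  count_filter_range _ _ _

theorem mem_lapSetOne {i n m : ℕ} : m ∈ lapSetOne i n ↔ m < n + 1 ∧ m ≠ i := by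
  simp [lapSetOne, -Multiset.range_succ, -Order.lt_add_one_iff]

theorem lapSetOne_eq_cons {i n : ℕ} (hi : i ≠ 0) :
    lapSetOne i n = 0 ::ₘ (Multiset.range (n + 1)).filter (fun k => k ≠ 0 ∧ k ≠ i) := by
  ext m
  simp only [count_lapSetOne, Multiset.count_cons, count_filter_range]
  split_ifs <;> omega

theorem lapSetTwo_eq_cons {j n : ℕ} (hj : 2 ≤ j) (hjn : j < n) :
    lapSetTwo 1 j n n = 0 ::ₘ n ::ₘ
      (Multiset.range (n + 1)).filter (fun k => k ≠ 0 ∧ k ≠ 1 ∧ k ≠ j) := by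
  ext m
  simp only [lapSetTwo, Multiset.count_filter, Multiset.count_cons,
    Multiset.count_eq_of_nodup (Multiset.nodup_range (n + 1)), Multiset.mem_range]
  split_ifs <;> omega

end RangeMultisets

/-! ### The three cases of the characterization. -/

section Realization

open SimpleGraph

variable {V : Type*} [Fintype V] {G : SimpleGraph V} {n : ℕ}

theorem count_zero_eq_one_cases {b : ℕ} {B : SimpleGraph (Fin b)} (hb : b ≤ 2)
    (h : (laplacianSpectrum B).count 0 = 1) :
    b = 1 ∧ HasNatSpectrum B {0} ∧ Nonempty (B ≃g graphK 1) ∨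
      b = 2 ∧ HasNatSpectrum B {0, 2} ∧ Nonempty (B ≃g graphK 2) := by
  have hle := Multiset.count_le_card 0 (laplacianSpectrum B)
  rw [card_laplacianSpectrum, Fintype.card_fin, h] at hle
  obtain rfl | rfl : b = 1 ∨ b = 2 := by omega
  · rw [simpleGraph_fin_one_eq B (graphK 1)]
    exact .inl ⟨rfl, hasNatSpectrum_graphK_one, ⟨Iso.refl⟩⟩
  · rcases simpleGraph_fin_two_eq B with rfl | rfl
    · rw [hasNatSpectrum_bot_two.count_zero] at h
      simp at h
    · exact .inr ⟨rfl, hasNatSpectrum_graphK_two, ⟨Iso.refl⟩⟩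

theorem count_zero_eq_two_cases {b : ℕ} {B : SimpleGraph (Fin b)} (hb : b ≤ 3)
    (h : (laplacianSpectrum B).count 0 = 2) :
    b = 2 ∧ HasNatSpectrum B {0, 0} ∧ Nonempty (B ≃g (graphK 2)ᶜ) ∨
      b = 3 ∧ HasNatSpectrum B {0, 0, 2} ∧ Nonempty (B ≃g (SimpleGraph.pathGraph 3)ᶜ) := by
  have hle := Multiset.count_le_card 0 (laplacianSpectrum B)
  rw [card_laplacianSpectrum, Fintype.card_fin, h] at hle
  obtain rfl | rfl : b = 2 ∨ b = 3 := by omega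
  · rcases simpleGraph_fin_two_eq B with rfl | rfl
    · have : (graphK 2)ᶜ = ⊥ := compl_top
      rw [this]
      exact .inl ⟨rfl, hasNatSpectrum_bot_two, ⟨Iso.refl⟩⟩
    · have h' := HasNatSpectrum.count_zero hasNatSpectrum_graphK_two
      change (laplacianSpectrum (⊤ : SimpleGraph (Fin 2))).count 0 = _ at h'
      rw [h] at h'
      simp at h'
  · right
    suffices he : Nonempty (B ≃g graphK 1 ⊕g graphK 2) by
      obtain ⟨f⟩ := nonempty_iso_compl_pathGraph_three
      exact ⟨rfl, (hasNatSpectrum_graphK_one.sum hasNatSpectrum_graphK_two).iso he,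
        he.map fun e => e.trans f⟩
    obtain ⟨a, c, A, C, ⟨e⟩, hA, hac, -, -, hC⟩ :=
      exists_connected_iso_sum_of_mem (Fintype.card_fin 3) B (k := 0)
        (by rw [Nat.cast_zero, ← Multiset.count_pos, h]; norm_num)
    have ha := Fin.pos_iff_nonempty.2 hA.nonempty
    have hle := Multiset.count_le_card 0 (laplacianSpectrum C)
    rw [card_laplacianSpectrum, Fintype.card_fin] at hle
    rcases count_zero_eq_one_cases (B := A) (by omega) ((connected_iff_count_zero A).1 hA) with
      ⟨ha', -, ⟨f⟩⟩ | ⟨ha', -, ⟨f⟩⟩ <;>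
    rcases count_zero_eq_one_cases (B := C) (by omega) (by omega) with
      ⟨hc', -, ⟨g⟩⟩ | ⟨hc', -, ⟨g⟩⟩
    · omega
    · exact ⟨e.trans (Iso.sumCongr f g)⟩
    · exact ⟨e.trans (Iso.sumComm.trans (Iso.sumCongr g f))⟩
    · omega

theorem exists_join_graphK_two (hV : Fintype.card V = n) {j : ℕ} (hj : 3 ≤ j) (hjn : j < n)
    (h : HasNatSpectrum G (lapSetTwo 1 j n n)) :
    ∃ X : SimpleGraph (Fin (n - 2)), GraphIsomorphic G (graphJoin (graphK 2) X) ∧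
      HasNatSpectrum X (0 ::ₘ lapSetOne (j - 2) (n - 3)) := by
  rw [lapSetTwo_eq_cons (by omega) hjn] at h
  have hc := h.compl hV
  rw [Multiset.map_cons, map_sub_filter_range, Nat.sub_self] at hc
  -- Since `j ≠ 2`, the eigenvalue `2` of `G` becomes `n - 2`. At most two vertices remain for the
  -- other two components.
  obtain ⟨a, b, A, B, e, hA, hab, ha, hs, hB⟩ := hc.exists_iso_sum hV (k := n - 2) (by
    simp only [Multiset.mem_cons, Multiset.mem_filter, Multiset.mem_range]; omega)
  simp only [Multiset.count_cons, count_filter_range] at hB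
  rcases count_zero_eq_two_cases (B := B) (by omega) (by
    split_ifs at hB <;> omega) with ⟨rfl, hB0, f⟩ | ⟨rfl, -⟩
  · obtain rfl : a = n - 2 := by omega
    refine ⟨Aᶜ, graphIsomorphic_graphJoin_of_compl e f, ?_⟩
    have hA' : HasNatSpectrum A (0 ::ₘ
        (Multiset.range (n - 2 + 1)).filter (fun k => k ≠ 0 ∧ k ≠ n - j)) := by
      refine hB0.of_add (hs.trans (congrArg _ ?_))
      ext m
      simp only [Multiset.count_cons, count_filter_range, Multiset.count_add,
        Multiset.insert_eq_cons, Multiset.count_singleton]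
      split_ifs <;> omega
    have hX := hA'.compl (Fintype.card_fin _)
    rw [map_sub_filter_range] at hX
    convert hX using 2
    ext m
    simp only [count_lapSetOne, count_filter_range]
    split_ifs <;> omega
  · omega

theorem lapRealizes_join_graphK_two (hn : 5 ≤ n) {j : ℕ} (hj : 3 ≤ j) (hjn : j < n)
    {H : SimpleGraph (Fin (n - 3))} (hH : LapRealizes H (lapSetOne (j - 2) (n - 3)))
    (e : GraphIsomorphic G (graphJoin (graphK 2) (graphUnion (graphK 1) H))) :
    LapRealizes G (lapSetTwo 1 j n n) := by
  have hU : HasNatSpectrum (graphUnion (graphK 1) H) (0 ::ₘ lapSetOne (j - 2) (n - 3)) :=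
    hasNatSpectrum_graphK_one.sum hH.2
  have hJ := hasNatSpectrum_graphK_two.join (S := {2}) (p := 2) (q := n - 2) (by simp)
    (by simp; omega) hU
  have hS : lapSetTwo 1 j n n = 0 ::ₘ (2 + (n - 2)) ::ₘ (({2} : Multiset ℕ).map
      (fun k => k + (n - 2)) + (lapSetOne (j - 2) (n - 3)).map (fun k => k + 2)) := by
    rw [lapSetTwo_eq_cons (by omega) hjn, lapSetOne, map_add_filter_range]
    ext m
    simp only [Multiset.count_cons, count_filter_range, Multiset.count_add,
        Multiset.map_singleton, Multiset.count_singleton]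
    split_ifs <;> omega
  rw [← hS] at hJ
  refine HasNatSpectrum.lapRealizes_iff.2 ⟨?_, hJ.iso e⟩
  rw [lapSetTwo_eq_cons (by omega) hjn]
  simp only [Multiset.count_cons, count_filter_range]
  split_ifs <;> omega

/-- A graph on `m + 1` vertices whose spectrum has exactly two zeros and contains `m`
is the disjoint union of an isolated vertex and a connected graph. -/
theorem exists_iso_graphUnion_graphK_one {m : ℕ} {S : Multiset ℕ} {X : SimpleGraph V}
    (hV : Fintype.card V = m + 1) (h : HasNatSpectrum X (0 ::ₘ S)) (hS : S.count 0 = 1)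
    (hm : m ∈ S) :
    ∃ H : SimpleGraph (Fin m), LapRealizes H S ∧ Nonempty (X ≃g graphUnion (graphK 1) H) := by
  obtain ⟨a, b, A, B, ⟨e⟩, hA, hab, ha, hs, hB⟩ :=
    h.exists_iso_sum hV (Multiset.mem_cons_of_mem hm)
  simp only [Multiset.count_cons_self, hS] at hB
  rcases count_zero_eq_one_cases (B := B) (by omega) (by omega) with
    ⟨rfl, hB0, ⟨f⟩⟩ | ⟨rfl, -⟩
  · obtain rfl : a = m := by omega
    refine ⟨A, ⟨hA, hB0.of_add (hs.trans (congrArg _ ?_))⟩,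
      ⟨e.trans (Iso.sumComm.trans (Iso.sumCongr f Iso.refl))⟩⟩
    rw [add_comm, Multiset.singleton_add]
  · omega

theorem lapRealizes_middle_iff (hn : 5 ≤ n) (hV : Fintype.card V = n) {j : ℕ} (hj : 3 ≤ j)
    (hjn : j ≤ n - 2) :
    LapRealizes G (lapSetTwo 1 j n n) ↔
      ∃ H : SimpleGraph (Fin (n - 3)), LapRealizes H (lapSetOne (j - 2) (n - 3)) ∧
        GraphIsomorphic G (graphJoin (graphK 2) (graphUnion (graphK 1) H)) := by
  constructor
  · intro h
    obtain ⟨X, ⟨e⟩, hX⟩ := exists_join_graphK_two hV hj (by omega) h.2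
    obtain ⟨H, hH, f⟩ := exists_iso_graphUnion_graphK_one (m := n - 3) (by simp; omega) hX
      (by rw [count_lapSetOne, if_pos (by omega)]) (mem_lapSetOne.2 (by omega))
    obtain ⟨g⟩ := graphJoin_congr ⟨Iso.refl (G := graphK 2)⟩ f
    exact ⟨H, hH, ⟨e.trans g⟩⟩
  · rintro ⟨H, hH, e⟩
    exact lapRealizes_join_graphK_two hn hj (by omega) hH e

theorem lapRealizes_last_iff (hn : 5 ≤ n) (hV : Fintype.card V = n) :
    LapRealizes G (lapSetTwo 1 (n - 1) n n) ↔
      (∃ H : SimpleGraph (Fin (n - 4)), LapRealizes H (lapSetOne 2 (n - 4)) ∧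
        GraphIsomorphic G (graphJoin (graphK 2) (graphUnion (graphK 2) H))) ∨
      (∃ H : SimpleGraph (Fin (n - 3)), LapRealizes H (lapSetOne (n - 3) (n - 3)) ∧
        GraphIsomorphic G (graphJoin (graphK 2) (graphUnion (graphK 1) H))) := by
  have hnn : n - 1 - 2 = n - 3 := by omega
  constructor
  · intro h
    obtain ⟨X, ⟨e⟩, hX⟩ := exists_join_graphK_two hV (by omega) (by omega) h.2
    rw [hnn] at hX
    -- Here `n - 3` is the missing value, so `n - 4` is the largest eigenvalue and one or two
    -- vertices are left over.
    obtain ⟨a, b, A, B, ⟨e'⟩, hA, hab, ha, hs, hB⟩ :=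
      hX.exists_iso_sum (Fintype.card_fin _) (k := n - 4)
        (Multiset.mem_cons_of_mem (mem_lapSetOne.2 (by omega)))
    rw [Multiset.count_cons_self, count_lapSetOne, if_pos (by omega)] at hB
    rcases count_zero_eq_one_cases (B := B) (by omega) (by omega) with
      ⟨rfl, hB0, ⟨f⟩⟩ | ⟨rfl, hB0, ⟨f⟩⟩
    · right
      obtain rfl : a = n - 3 := by omega
      obtain ⟨g⟩ := graphJoin_congr ⟨Iso.refl (G := graphK 2)⟩
        ⟨e'.trans (Iso.sumComm.trans (Iso.sumCongr f (Iso.refl (G := A))))⟩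
      refine ⟨A, ⟨hA, hB0.of_add (hs.trans (congrArg _ ?_))⟩, ⟨e.trans g⟩⟩
      rw [add_comm, Multiset.singleton_add]
    · left
      obtain rfl : a = n - 4 := by omega
      obtain ⟨g⟩ := graphJoin_congr ⟨Iso.refl (G := graphK 2)⟩
        ⟨e'.trans (Iso.sumComm.trans (Iso.sumCongr f (Iso.refl (G := A))))⟩
      refine ⟨A, ⟨hA, hB0.of_add (hs.trans (congrArg _ ?_))⟩, ⟨e.trans g⟩⟩
      -- The eigenvalue `2` of the `K_2` component must occur in the whole spectrum, which forces `n
      -- - 3 ≠ 2` and so excludes `n = 5`.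
      have h2 : 2 ∈ 0 ::ₘ lapSetOne (n - 3) (n - 3) := by
        have : (2 : ℝ) ∈ laplacianSpectrum A + laplacianSpectrum B := by
          rw [hB0]; simp
        rw [hs] at this
        exact (Multiset.mem_map_of_injective Nat.cast_injective).1 (by exact_mod_cast this)
      rw [Multiset.mem_cons, mem_lapSetOne] at h2
      ext m
      simp only [Multiset.count_cons, Multiset.count_add, count_lapSetOne,
        Multiset.insert_eq_cons, Multiset.count_singleton]
      split_ifs <;> omega
  · rintro (⟨H, hH, e⟩ | ⟨H, hH, e⟩)
    · have hcard := HasNatSpectrum.card_eq hH.2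
      -- For `n = 5` the prescribed spectrum is `{0, 1}`, too large for one vertex.
      have hn6 : 6 ≤ n := by
        by_contra hlt
        obtain rfl : n = 5 := by omega
        revert hcard
        decide
      have hU : HasNatSpectrum (graphUnion (graphK 2) H) (0 ::ₘ 2 ::ₘ lapSetOne 2 (n - 4)) :=
        hasNatSpectrum_graphK_two.sum hH.2
      have hJ := hasNatSpectrum_graphK_two.join (S := {2}) (p := 2) (q := n - 2) (by simp)
        (by simp; omega) hU
      have hS : lapSetTwo 1 (n - 1) n n = 0 ::ₘ (2 + (n - 2)) ::ₘ (({2} : Multiset ℕ).map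
          (fun k => k + (n - 2)) + (2 ::ₘ lapSetOne 2 (n - 4)).map (fun k => k + 2)) := by
        rw [lapSetTwo_eq_cons (by omega) (by omega), lapSetOne, Multiset.map_cons,
          map_add_filter_range]
        ext m
        simp only [Multiset.count_cons, count_filter_range, Multiset.count_add,
          Multiset.map_singleton, Multiset.count_singleton]
        split_ifs <;> omega
      rw [← hS] at hJ
      refine HasNatSpectrum.lapRealizes_iff.2 ⟨?_, hJ.iso e⟩
      rw [lapSetTwo_eq_cons (by omega) (by omega)]
      simp only [Multiset.count_cons, count_filter_range]
      split_ifs <;> omega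
    · exact lapRealizes_join_graphK_two hn (by omega) (by omega) (by rwa [hnn]) e

theorem lapRealizes_first_iff (hn : 5 ≤ n) (hV : Fintype.card V = n) :
    LapRealizes G (lapSetTwo 1 2 n n) ↔
      (∃ H : SimpleGraph (Fin (n - 4)), LapRealizes H (lapSetOne (n - 5) (n - 4)) ∧
        GraphIsomorphic G (graphJoin (SimpleGraph.pathGraph 3) (graphUnion (graphK 1) H))) ∨
      (∃ H : SimpleGraph (Fin (n - 2)), LapRealizes H (lapSetOne (n - 2) (n - 2)) ∧
        GraphIsomorphic G (graphJoin (graphK 2) H)) := by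
  have hzero : (lapSetTwo 1 2 n n).count 0 = 1 := by
    rw [lapSetTwo_eq_cons le_rfl (by omega)]
    simp only [Multiset.count_cons, count_filter_range]
    split_ifs <;> omega
  constructor
  · intro h
    have h := h.2
    rw [lapSetTwo_eq_cons le_rfl (by omega)] at h
    have hc := HasNatSpectrum.compl hV h
    rw [Multiset.map_cons, map_sub_filter_range, Nat.sub_self] at hc
    -- With `2` also missing from `G`, the largest eigenvalue of the complement is only `n - 3`; the
    -- two remaining components may have three vertices, whence `P_3`.
    obtain ⟨a, b, A, B, e, hA, hab, ha, hs, hB⟩ := hc.exists_iso_sum hV (k := n - 3) (by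
      simp only [Multiset.mem_cons, Multiset.mem_filter, Multiset.mem_range]; omega)
    simp only [Multiset.count_cons, count_filter_range] at hB
    rcases count_zero_eq_two_cases (B := B) (by omega) (by
      split_ifs at hB <;> omega) with ⟨rfl, hB0, f⟩ | ⟨rfl, hB0, f⟩
    · right
      obtain rfl : a = n - 2 := by omega
      have hA' : HasNatSpectrum A (0 ::ₘ
          (Multiset.range (n - 2 + 1)).filter (fun k => k ≠ 0 ∧ k ≠ n - 2)) := by
        refine hB0.of_add (hs.trans (congrArg _ ?_))
        ext m
        simp only [Multiset.count_cons, count_filter_range, Multiset.count_add,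
          Multiset.insert_eq_cons, Multiset.count_singleton]
        split_ifs <;> omega
      have hX := hA'.compl (Fintype.card_fin _)
      rw [map_sub_filter_range] at hX
      refine ⟨Aᶜ, HasNatSpectrum.lapRealizes_iff.2 ⟨?_, ?_⟩,
        graphIsomorphic_graphJoin_of_compl e f⟩
      · rw [count_lapSetOne, if_pos (by omega)]
      · rw [lapSetOne_eq_cons (by omega)]
        convert hX using 2
        ext m
        simp only [count_filter_range]
        split_ifs <;> omega
    · left
      obtain rfl : a = n - 3 := by omega
      have hA' : HasNatSpectrum A (0 ::ₘ
          (Multiset.range (n - 3 + 1)).filter (fun k => k ≠ 0 ∧ k ≠ 2)) := by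
        refine hB0.of_add (hs.trans (congrArg _ ?_))
        ext m
        simp only [Multiset.count_cons, count_filter_range, Multiset.count_add,
          Multiset.insert_eq_cons, Multiset.count_singleton]
        split_ifs <;> omega
      -- For `n = 5` a connected graph on two vertices would have spectrum `{0, 1}`, but it is
      -- `K_2`.
      have hn6 : 6 ≤ n := by
        by_contra hlt
        obtain rfl : n = 5 := by omega
        rcases count_zero_eq_one_cases (B := A) le_rfl ((connected_iff_count_zero A).1 hA) with
          ⟨h1, -⟩ | ⟨-, h2, -⟩
        · omega
        · have := h2.unique hA'
          revert this
          decide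
      have hX := hA'.compl (Fintype.card_fin _)
      rw [map_sub_filter_range] at hX
      have hS : (Multiset.range (n - 3 + 1)).filter (fun m => n - 3 - m ≠ 0 ∧ n - 3 - m ≠ 2) =
          lapSetOne (n - 5) (n - 4) := by
        ext m
        simp only [count_lapSetOne, count_filter_range]
        split_ifs <;> omega
      rw [hS] at hX
      obtain ⟨H, hH, f'⟩ := exists_iso_graphUnion_graphK_one (m := n - 4) (by simp; omega) hX
        (by rw [count_lapSetOne, if_pos (by omega)]) (mem_lapSetOne.2 (by omega))
      obtain ⟨g⟩ := graphJoin_congr ⟨Iso.refl (G := SimpleGraph.pathGraph 3)⟩ f'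
      obtain ⟨e'⟩ := graphIsomorphic_graphJoin_of_compl e f
      exact ⟨H, hH, ⟨e'.trans g⟩⟩
  · rintro (⟨H, hH, e⟩ | ⟨H, hH, e⟩)
    -- Connectedness of `H` puts `0` in its spectrum, so `n - 5 ≠ 0`; the multiset identity below
    -- needs this.
    · have hz := (HasNatSpectrum.lapRealizes_iff.1 hH).1
      rw [count_lapSetOne] at hz
      have hU : HasNatSpectrum (graphUnion (graphK 1) H) (0 ::ₘ lapSetOne (n - 5) (n - 4)) :=
        hasNatSpectrum_graphK_one.sum hH.2
      have hJ := hasNatSpectrum_pathGraph_three.join (S := {1, 3}) (p := 3) (q := n - 3) (by simp)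
        (by simp; omega) hU
      have hS : lapSetTwo 1 2 n n = 0 ::ₘ (3 + (n - 3)) ::ₘ (({1, 3} : Multiset ℕ).map
          (fun k => k + (n - 3)) + (lapSetOne (n - 5) (n - 4)).map (fun k => k + 3)) := by
        rw [lapSetTwo_eq_cons (by omega) (by omega), lapSetOne, map_add_filter_range]
        ext m
        simp only [Multiset.count_cons, count_filter_range, Multiset.count_add,
          Multiset.insert_eq_cons, Multiset.map_cons, Multiset.map_singleton,
          Multiset.count_singleton]
        split_ifs at hz ⊢ <;> omega
      rw [← hS] at hJ
      exact HasNatSpectrum.lapRealizes_iff.2 ⟨hzero, hJ.iso e⟩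
    · have hH' : HasNatSpectrum H (lapSetOne (n - 2) (n - 2)) := hH.2
      rw [lapSetOne_eq_cons (by omega)] at hH'
      have hJ := hasNatSpectrum_graphK_two.join (S := {2}) (p := 2) (q := n - 2) (by simp)
        (by simp) hH'
      have hS : lapSetTwo 1 2 n n = 0 ::ₘ (2 + (n - 2)) ::ₘ (({2} : Multiset ℕ).map
          (fun k => k + (n - 2)) + ((Multiset.range (n - 2 + 1)).filter
            (fun k => k ≠ 0 ∧ k ≠ n - 2)).map (fun k => k + 2)) := by
        rw [lapSetTwo_eq_cons (by omega) (by omega), map_add_filter_range]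
        ext m
        simp only [Multiset.count_cons, count_filter_range, Multiset.count_add,
          Multiset.map_singleton, Multiset.count_singleton]
        split_ifs <;> omega
      rw [← hS] at hJ
      exact HasNatSpectrum.lapRealizes_iff.2 ⟨hzero, hJ.iso e⟩

end Realization

theorem mainTheorem2 {V : Type*} [Fintype V] (G : SimpleGraph V) (n : ℕ) (hn : 5 ≤ n)
    (hV : Fintype.card V = n) :
    (LapRealizes G (lapSetTwo 1 2 n n) ↔
      (∃ H : SimpleGraph (Fin (n - 4)), LapRealizes H (lapSetOne (n - 5) (n - 4)) ∧
        GraphIsomorphic G (graphJoin (SimpleGraph.pathGraph 3) (graphUnion (graphK 1) H))) ∨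
      (∃ H : SimpleGraph (Fin (n - 2)), LapRealizes H (lapSetOne (n - 2) (n - 2)) ∧
        GraphIsomorphic G (graphJoin (graphK 2) H))) ∧
    (∀ j : ℕ, 3 ≤ j → j ≤ n - 2 →
      (LapRealizes G (lapSetTwo 1 j n n) ↔
        ∃ H : SimpleGraph (Fin (n - 3)), LapRealizes H (lapSetOne (j - 2) (n - 3)) ∧
          GraphIsomorphic G (graphJoin (graphK 2) (graphUnion (graphK 1) H)))) ∧
    (LapRealizes G (lapSetTwo 1 (n - 1) n n) ↔
      (∃ H : SimpleGraph (Fin (n - 4)), LapRealizes H (lapSetOne 2 (n - 4)) ∧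
        GraphIsomorphic G (graphJoin (graphK 2) (graphUnion (graphK 2) H))) ∨
      (∃ H : SimpleGraph (Fin (n - 3)), LapRealizes H (lapSetOne (n - 3) (n - 3)) ∧
        GraphIsomorphic G (graphJoin (graphK 2) (graphUnion (graphK 1) H)))) := by
  exact ⟨lapRealizes_first_iff hn hV, fun _ hj hjn => lapRealizes_middle_iff hn hV hj hjn,
    lapRealizes_last_iff hn hV⟩
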